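/- Let $\mathsf A,\mathsf B\subset\mathbb R^n$ be two $r$-dimensional subspaces of Euclidean space, and let $Cl_n$ be the Clifford (geometric) algebra of $\mathbb R^n$, with $x^2=|x|^2$ for vectors $x$. Write $\langle M\rangle_k$ for the $k$-vector part, $\widetilde M$ for the reverse and $|M|=\sqrt{\langle M\widetilde M\rangle_0}$ for the modulus of a multivector $M$. There are integers $s,t\ge 0$ with $s+t\le r$, orthonormal bases $a_1,\dots,a_r$ of $\mathsf A$ and $b_1,\dots,b_r$ of $\mathsf B$ (principal vectors) and angles $\theta_1,\dots,\theta_r\in[0,\pi/2]$ (principal angles) such that $a_k\cdot b_k=\cos\theta_k$ for all $k$, $a_k\cdot b_l=0$ for $k\ne l$, $\theta_k=0$ exactly for $k\le s$, and $\theta_k=\pi/2$ exactly for $k>r-t$. Let any such data be given, so that $s$ principal angles are $0$ and $t$ are $\pi/2$. Put $c_k=\cos\theta_k$, $s_k=\sin\theta_k$, and $i_k=(a_k\wedge b_k)/|a_k\wedge b_k|$ for $k>s$ (and $i_k=0$ for $k\le s$). Let $A=a_1'\wedge\dots\wedge a_r'$ and $B=b_1'\wedge\dots\wedge b_r'$ be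 $r$-blades, where $(a'_k)$ and $(b'_k)$ are arbitrary bases of $\mathsf A$ and $\mathsf B$, and let $M=A\widetilde B/(|A||B|)$. Then: 1. $s=\dim(\mathsf A\cap\mathsf B)$; $a_kb_k=c_k+s_ki_k$ for all $k$; $i_k^2=-1$ for $k>s$; and the $i_k$ commute with each other. 2. There are signs $\varepsilon_A,\varepsilon_B\in\{1,-1\}$ with $A=\varepsilon_A|A|\,a_1a_2\cdots a_r$ and $B=\varepsilon_B|B|\,b_1b_2\cdots b_r$. With $\varepsilon=\varepsilon_A\varepsilon_B$ (so $\varepsilon=1$ if the blades are oriented like the principal vectors), $$M=\varepsilon\Big(\prod_{k=s+1}^{r-t}(c_k+i_ks_k)\Big)i_{r-t+1}\cdots i_r=\varepsilon\Big(\sum_{S\subseteq\{s+1,\dots,r-t\}}\ \prod_{k\in S}s_k\prod_{k\notin S}c_k\ \prod_{k\in S}i_k\Big)i_{r-t+1}\cdots i_r .$$ 3. The lowest non-zero grade of $M$ is $2t$, with $\langle M\rangle_{2t}=\varepsilon\,c_{s+1}\cdots c_{r-t}\;i_{r-t+1}\cdots i_r$ and $|\langle M\rangle_{2t}|=\prod_{k=s+1}^{r-t}\cos\theta_k$.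 4. The highest non-zero grade of $M$ is $2(r-s)$, with $\langle M\rangle_{2(r-s)}=\varepsilon\,s_{s+1}\cdots s_{r-t}\;i_{s+1}\cdots i_r$ and $|\langle M\rangle_{2(r-s)}|=\prod_{k=s+1}^{r-t}\sin\theta_k$. 5. $L=\langle M\rangle_{2t}$ is invertible in $Cl_n$, and $D=ML^{-1}=L^{-1}M$ has highest non-zero grade $2(r-s-t)$, scalar part $\langle D\rangle_0=1$ and bivector part $\langle D\rangle_2=\sum_{k=s+1}^{r-t}\tan\theta_k\;i_k$. Empty products are $1$ and empty sums are $0$. -/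

import Mathlib

open scoped InnerProductSpace

noncomputable section

namespace GA

/-- The Euclidean space `ℝⁿ`. -/
abbrev E (n : ℕ) : Type := EuclideanSpace ℝ (Fin n)

/-- The quadratic form `x ↦ x ⬝ x` of the Euclidean space `ℝⁿ`. -/
def euclideanForm (n : ℕ) : QuadraticForm ℝ (E n) :=
  LinearMap.BilinMap.toQuadraticMap (innerₗ (E n))

/-- The geometric (Clifford) algebra `Cl_n = Cl(ℝⁿ)`, with `x * x = x ⬝ x` for vectors `x`. -/
abbrev Cl (n : ℕ) : Type := CliffordAlgebra (euclideanForm n)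

/-- A vector of `ℝⁿ` as an element of `Cl_n`. -/
abbrev vec {n : ℕ} (x : E n) : Cl n := CliffordAlgebra.ι (euclideanForm n) x

/-- The canonical identification of the vector spaces `Cl_n` and `Λ(ℝⁿ)`: a product of pairwise
orthogonal vectors corresponds to their exterior product. -/
def toExt (n : ℕ) : Cl n ≃ₗ[ℝ] ExteriorAlgebra ℝ (E n) :=
  CliffordAlgebra.equivExterior (euclideanForm n)

/-- The `k`-vector part `⟨M⟩_k` of a multivector. -/
def gradePart {n : ℕ} (k : ℕ) (M : Cl n) : Cl n :=
  (toExt n).symm (GradedAlgebra.proj (fun i : ℕ ↦ ⋀[ℝ]^i (E n)) k (toExt n M))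

/-- The scalar part of a multivector, as a real number. -/
def scalarPart {n : ℕ} (M : Cl n) : ℝ := ExteriorAlgebra.algebraMapInv (toExt n M)

/-- The modulus `|M|` of a multivector, `|M|² = ⟨M M̃⟩₀`. -/
def modulus {n : ℕ} (M : Cl n) : ℝ := √(scalarPart (M * CliffordAlgebra.reverse M))

/-- The outer product `v₁ ∧ ⋯ ∧ v_r` of vectors, as an element of `Cl_n`. -/
def wedge {n r : ℕ} (v : Fin r → E n) : Cl n := (toExt n).symm (ExteriorAlgebra.ιMulti ℝ r v)

/-- `A` is an `r`-blade representing the subspace `U`: the outer product of some `r` linearly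
independent vectors that span `U`. -/
def IsBladeOf {n : ℕ} (r : ℕ) (U : Submodule ℝ (E n)) (A : Cl n) : Prop :=
  ∃ v : Fin r → E n, LinearIndependent ℝ v ∧ Submodule.span ℝ (Set.range v) = U ∧ A = wedge v

/-- `a`, `b` are principal vectors and `θ` the corresponding principal angles of the two
`r`-dimensional subspaces `U`, `W`: `a` and `b` are orthonormal bases of `U` and `W` with
`a_k ⬝ b_k = cos θ_k`, `0 ≤ θ_k ≤ π/2`, and `a_k ⬝ b_l = 0` for `k ≠ l`. -/
structure IsPrincipal {n r : ℕ} (U W : Submodule ℝ (E n)) (a b : Fin r → E n) (θ : Fin r → ℝ) :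
    Prop where
  orthonormal_left : Orthonormal ℝ a
  orthonormal_right : Orthonormal ℝ b
  span_left : Submodule.span ℝ (Set.range a) = U
  span_right : Submodule.span ℝ (Set.range b) = W
  angle_mem : ∀ k, θ k ∈ Set.Icc 0 (Real.pi / 2)
  inner_same : ∀ k, ⟪a k, b k⟫_ℝ = Real.cos (θ k)
  inner_ne : ∀ k l, k ≠ l → ⟪a k, b l⟫_ℝ = 0

/-- Exactly the first `s` of the angles `θ` are `0` and exactly the last `t` of them are `π/2`.
The index set `Fin r` starts at `0`. -/
structure IsArranged {r : ℕ} (s t : ℕ) (θ : Fin r → ℝ) : Prop where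
  add_le : s + t ≤ r
  eq_zero_iff : ∀ k : Fin r, θ k = 0 ↔ (k : ℕ) < s
  eq_pi_div_two_iff : ∀ k : Fin r, θ k = Real.pi / 2 ↔ r - t ≤ (k : ℕ)

/-- The indices `s+1, …, r-t` (counted from `1`). -/
def mid (r s t : ℕ) : Finset (Fin r) := {k : Fin r | s ≤ (k : ℕ) ∧ (k : ℕ) < r - t}

/-- The indices `r-t+1, …, r` (counted from `1`). -/
def last (r t : ℕ) : Finset (Fin r) := {k : Fin r | r - t ≤ (k : ℕ)}

/-- The geometric product of the `f k`, `k ∈ S`, in increasing order of `k`. -/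
def oprod {n r : ℕ} (S : Finset (Fin r)) (f : Fin r → Cl n) : Cl n := (S.sort.map f).prod

/-- The unit bivector `(x ∧ y) / |x ∧ y|` of the oriented plane spanned by `x` and `y`. -/
def unitBivector {n : ℕ} (x y : E n) : Cl n := (modulus (wedge ![x, y]))⁻¹ • wedge ![x, y]

/-- The geometric product `A B̃` after division by `|A| |B|`. -/
def normedProduct {n : ℕ} (A B : Cl n) : Cl n :=
  (modulus A * modulus B)⁻¹ • (A * CliffordAlgebra.reverse B)

end GA

end

/-! ### Products of orthogonal vectors, grades and blades. -/

namespace GA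

variable {n r : ℕ}

/-! Write `b k = c_k a_k + s_k f_k` with `f_k` = `normalVec`. All the `a_k`, `f_k` are pairwise
orthogonal, and `f_k` is a unit vector unless `θ k = 0`, where it is `0`. Hence `i_k = a_k f_k`, the
`i_k` commute, and `a_k b_k = c_k + s_k i_k`.

An alternating `r`-linear map on an `r`-dimensional space is determined by its value on one basis,
so `A` and `B` are real multiples of `a_1 ⋯ a_r` and `b_1 ⋯ b_r`. In `a_1 ⋯ a_r b_r ⋯ b_1` each
`b_k` commutes with `a_j b_j` for `j ≠ k`, so the product collapses to that of the `a_k b_k`. A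
factor with angle `0` is `1`, and one with angle `π/2` is `i_k`.

Expanding the remaining factors gives one term for each subset `S` of `mid`. It is a multiple of a
product of `2(|S| + t)` orthogonal vectors, hence homogeneous. The terms for `∅` and `mid` have
positive coefficients up to the sign `ε` and give the extreme grades. Dividing by the lowest part
removes the factors of angle `π/2` and leaves the same expansion, normalised by the product of the
cosines.

Principal vectors exist by the singular value decomposition of the orthogonal projection from `U` to
`W`. -/

theorem vec_mul_self (x : E n) : vec x * vec x = algebraMap ℝ (Cl n) ⟪x, x⟫_ℝ := by
  rw [CliffordAlgebra.ι_sq_scalar]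
  rfl

theorem vec_mul_vec_of_inner_eq_zero {x y : E n} (h : ⟪x, y⟫_ℝ = 0) :
    vec x * vec y = -(vec y * vec x) := by
  have h1 : QuadraticMap.polar (euclideanForm n) x y = 0 := by
    have hs : ⟪y, x⟫_ℝ = 0 := by rw [real_inner_comm]; exact h
    simp [QuadraticMap.polar, euclideanForm, inner_add_right, h, hs]
  have := CliffordAlgebra.ι_mul_ι_add_swap (Q := euclideanForm n) x y
  rw [h1, map_zero] at this
  exact eq_neg_of_add_eq_zero_left this

/-- Contraction with a functional that vanishes on all factors kills a product of vectors. -/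
theorem contractLeft_list_prod_eq_zero (d : Module.Dual ℝ (E n)) (l : List (E n))
    (h : ∀ y ∈ l, d y = 0) :
    CliffordAlgebra.contractLeft (Q := (0 : QuadraticForm ℝ (E n))) d
      (l.map (ExteriorAlgebra.ι ℝ)).prod = 0 := by
  induction l with
  | nil => simp
  | cons x l ih =>
    rw [List.map_cons, List.prod_cons]
    have h2 := CliffordAlgebra.contractLeft_ι_mul (Q := (0 : QuadraticForm ℝ (E n))) (d := d) x
      (l.map (ExteriorAlgebra.ι ℝ)).prod
    refine h2.trans ?_
    rw [ih fun y hy => h y (List.mem_cons_of_mem _ hy), h x List.mem_cons_self]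
    simp

theorem toExt_one : toExt n 1 = 1 := by
  simp [toExt, CliffordAlgebra.equivExterior, CliffordAlgebra.changeFormEquiv]

/-- The geometric product of pairwise orthogonal vectors is their exterior product. -/
theorem toExt_list_prod (l : List (E n)) (h : l.Pairwise fun x y => ⟪x, y⟫_ℝ = 0) :
    toExt n (l.map vec).prod = (l.map (ExteriorAlgebra.ι ℝ)).prod := by
  induction l with
  | nil => simpa using toExt_one
  | cons x l ih =>
    rw [List.pairwise_cons] at h
    have ih := ih h.2
    rw [List.map_cons, List.map_cons, List.prod_cons, List.prod_cons]
    -- In the exterior algebra, left Clifford multiplication by `x` is exterior multiplication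
    -- corrected by contraction with `⟪x, ·⟫`, up to sign. The remaining factors are orthogonal to
    -- `x`, so the correction vanishes.
    have h2 := CliffordAlgebra.changeForm_ι_mul (Q := euclideanForm n)
      (h := CliffordAlgebra.changeForm.associated_neg_proof) x (l.map vec).prod
    refine h2.trans ?_
    change _ * toExt n _ - CliffordAlgebra.contractLeft _ (toExt n _) = _
    rw [ih, contractLeft_list_prod_eq_zero, sub_zero]
    · intro y hy
      have hxy := h.1 y hy
      have hyx : ⟪y, x⟫_ℝ = 0 := by rw [real_inner_comm]; exact hxy
      simp [QuadraticMap.associated, QuadraticMap.isOrtho_def, euclideanForm, inner_add_right,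
        hxy, hyx]

theorem wedge_eq_list_prod (v : Fin r → E n) (h : Pairwise fun k l => ⟪v k, v l⟫_ℝ = 0) :
    wedge v = ((List.ofFn v).map vec).prod := by
  rw [wedge, LinearEquiv.symm_apply_eq, toExt_list_prod, ExteriorAlgebra.ιMulti_apply,
    List.map_ofFn]
  · rfl
  · rw [List.pairwise_ofFn]
    exact fun i j hij => h hij.ne

/-- `M` is a `k`-vector. -/
def IsKVector (k : ℕ) (M : Cl n) : Prop := toExt n M ∈ ⋀[ℝ]^k (E n)

theorem IsKVector.gradePart_eq {k : ℕ} {M : Cl n} (h : IsKVector k M) (j : ℕ) :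
    gradePart j M = if j = k then M else 0 := by
  unfold gradePart
  rw [LinearEquiv.symm_apply_eq, GradedAlgebra.proj_apply]
  split_ifs with hj
  · subst hj
    exact DirectSum.decompose_of_mem_same _ h
  · rw [map_zero]
    exact DirectSum.decompose_of_mem_ne _ h (Ne.symm hj)

/-- Zero vectors may occur, since `0` is a `k`-vector for every `k`; this admits indices with angle
`0` later on. -/
theorem isKVector_list_prod (l : List (E n)) (h : l.Pairwise fun x y => ⟪x, y⟫_ℝ = 0) :
    IsKVector l.length (l.map vec).prod := by
  unfold IsKVector
  rw [toExt_list_prod l h]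
  have : ∀ l : List (E n), (l.map (ExteriorAlgebra.ι ℝ)).prod ∈ ⋀[ℝ]^l.length (E n) := by
    intro l
    have h1 := ExteriorAlgebra.ιMulti_range ℝ (M := E n) l.length ⟨l.get, rfl⟩
    rw [ExteriorAlgebra.ιMulti_apply] at h1
    rwa [show (List.ofFn fun i => ExteriorAlgebra.ι ℝ (l.get i)) =
      l.map (ExteriorAlgebra.ι ℝ) by
        rw [← Function.comp_def, ← List.map_ofFn, List.ofFn_get]] at h1
  exact this l

/-- The `k`-vector part as a linear map. -/
noncomputable def gradePartₗ (k : ℕ) : Cl n →ₗ[ℝ] Cl n :=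
  (toExt n).symm.toLinearMap ∘ₗ GradedAlgebra.proj (fun i : ℕ ↦ ⋀[ℝ]^i (E n)) k ∘ₗ
    (toExt n).toLinearMap

theorem gradePart_smul (k : ℕ) (c : ℝ) (M : Cl n) : gradePart k (c • M) = c • gradePart k M :=
  map_smul (gradePartₗ k) c M

theorem gradePart_sum {ι : Type*} (k : ℕ) (s : Finset ι) (M : ι → Cl n) :
    gradePart k (∑ x ∈ s, M x) = ∑ x ∈ s, gradePart k (M x) :=
  map_sum (gradePartₗ k) M s

/-- All moduli needed are found this way, from multiples of products of unit vectors. -/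
theorem modulus_smul_of_mul_reverse_eq_one {M : Cl n} (h : M * CliffordAlgebra.reverse M = 1)
    (c : ℝ) : modulus (c • M) = |c| := by
  unfold modulus scalarPart
  rw [map_smul, smul_mul_smul_comm, h, map_smul, toExt_one, map_smul, map_one, smul_eq_mul,
    mul_one, Real.sqrt_mul_self_eq_abs]

theorem list_prod_mul_reverse (l : List (E n)) (h : ∀ x ∈ l, ‖x‖ = 1) :
    (l.map vec).prod * CliffordAlgebra.reverse (l.map vec).prod = 1 := by
  induction l with
  | nil => simp
  | cons x l ih =>
    have ih := ih fun y hy => h y (List.mem_cons_of_mem _ hy)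
    have hx : vec x * vec x = 1 := by
      rw [vec_mul_self, real_inner_self_eq_norm_sq, h x List.mem_cons_self]
      simp
    rw [List.map_cons, List.prod_cons, CliffordAlgebra.reverse.map_mul, CliffordAlgebra.reverse_ι,
      mul_assoc, ← mul_assoc _ _ (vec x), ih, one_mul, hx]

theorem oprod_univ (f : Fin r → Cl n) : oprod Finset.univ f = (List.ofFn f).prod := by
  unfold oprod
  rw [Fin.sort_univ, List.ofFn_eq_map]

/-- A blade is a multiple of the product of an orthonormal basis of its subspace. -/
theorem IsBladeOf.exists_smul_oprod {U : Submodule ℝ (E n)} {A : Cl n} (hA : IsBladeOf r U A)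
    {a : Fin r → E n} (ha : Orthonormal ℝ a) (hspan : Submodule.span ℝ (Set.range a) = U) :
    ∃ ε : ℝ, (ε = 1 ∨ ε = -1) ∧ modulus A ≠ 0 ∧
      A = (ε * modulus A) • oprod Finset.univ (fun k => vec (a k)) := by
  obtain ⟨v, hv, hvs, rfl⟩ := hA
  subst hspan
  let e := Module.Basis.span ha.linearIndependent
  have he : ∀ k, (e k : E n) = a k := fun k => congrArg _ (Module.Basis.span_apply _ k)
  have hv_mem : ∀ k, v k ∈ Submodule.span ℝ (Set.range a) := fun k =>
    hvs ▸ Submodule.subset_span ⟨k, rfl⟩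
  let w : Fin r → Submodule.span ℝ (Set.range a) := fun k => ⟨v k, hv_mem k⟩
  have hw : LinearIndependent ℝ w :=
    LinearIndependent.of_comp (Submodule.subtype _) hv
  have hdet : e.det w ≠ 0 := by
    have hcard : Fintype.card (Fin r) = Module.finrank ℝ (Submodule.span ℝ (Set.range a)) :=
      (Module.finrank_eq_card_basis e).symm
    have h1 := ((Module.Basis.is_basis_iff_det e).1
      ⟨hw, hw.span_eq_top_of_card_eq_finrank' hcard⟩)
    exact h1.ne_zero
  -- Both sides are alternating, so it suffices to compare them on permutations of the basis `e`.
  have hmulti : (ExteriorAlgebra.ιMulti ℝ r).compLinearMap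
      (Submodule.subtype (Submodule.span ℝ (Set.range a))) =
      (LinearMap.toSpanSingleton ℝ _ (ExteriorAlgebra.ιMulti ℝ r a)).compAlternatingMap e.det := by
    refine Module.Basis.ext_alternating e fun σ hσ => ?_
    let τ : Equiv.Perm (Fin r) := Equiv.ofBijective σ (Finite.injective_iff_bijective.1 hσ)
    have h1 : (fun i => e (σ i)) = e ∘ τ := rfl
    rw [h1, AlternatingMap.map_perm, AlternatingMap.map_perm]
    congr 1
    simp only [AlternatingMap.compLinearMap_apply, LinearMap.compAlternatingMap_apply,
      Module.Basis.det_self, LinearMap.toSpanSingleton_apply, one_smul]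
    congr 1
    funext k
    exact he k
  have hA : wedge v = e.det w • oprod Finset.univ (fun k => vec (a k)) := by
    have h1 := DFunLike.congr_fun hmulti w
    have h2 : oprod Finset.univ (fun k => vec (a k)) = wedge a := by
      rw [wedge_eq_list_prod a fun i j hij => ha.2 hij, oprod_univ, List.map_ofFn]
      rfl
    rw [h2, wedge, wedge, ← map_smul]
    congr 1
  have hmod : modulus (wedge v) = |e.det w| := by
    rw [hA, modulus_smul_of_mul_reverse_eq_one]
    rw [oprod_univ]
    have := list_prod_mul_reverse (List.ofFn a) (by
      simpa [List.forall_mem_ofFn_iff] using ha.1)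
    rwa [List.map_ofFn] at this
  rw [hmod]
  rcases lt_or_gt_of_ne hdet with h | h
  · exact ⟨-1, Or.inr rfl, abs_ne_zero.2 hdet, by rw [abs_of_neg h, hA]; simp⟩
  · exact ⟨1, Or.inl rfl, abs_ne_zero.2 hdet, by rw [abs_of_pos h, hA]; simp⟩

end GA

/-! ### Existence of principal vectors; the intersection of the subspaces. -/

namespace GA

variable {n r : ℕ}

/-- The singular value decomposition of a linear map between spaces of the same dimension. -/
theorem exists_orthonormalBasis_apply_eq_smul {V V' : Type*} [NormedAddCommGroup V]
    [InnerProductSpace ℝ V] [FiniteDimensional ℝ V] [NormedAddCommGroup V']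
    [InnerProductSpace ℝ V'] [FiniteDimensional ℝ V'] (T : V →ₗ[ℝ] V')
    (hV : Module.finrank ℝ V = r) (hV' : Module.finrank ℝ V' = r) :
    ∃ (u : OrthonormalBasis (Fin r) ℝ V) (w : OrthonormalBasis (Fin r) ℝ V'),
      (Antitone fun k => ‖T (u k)‖) ∧
      ∀ k l, ⟪T (u k), w l⟫_ℝ = if k = l then ‖T (u k)‖ else 0 := by
  -- `T` maps eigenvectors of `T* T` to pairwise orthogonal vectors whose squared norms are the
  -- eigenvalues.
  have hsym : (T.adjoint ∘ₗ T).IsSymmetric := T.isSymmetric_adjoint_comp_self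
  let u := hsym.eigenvectorBasis hV
  let μ := hsym.eigenvalues hV
  have hTT : ∀ k l, ⟪T (u k), T (u l)⟫_ℝ = if k = l then μ k else 0 := by
    intro k l
    rw [← LinearMap.adjoint_inner_left]
    have h1 : T.adjoint (T (u k)) = μ k • u k := hsym.apply_eigenvectorBasis hV k
    rw [h1, real_inner_smul_left, orthonormal_iff_ite.1 u.orthonormal k l]
    split_ifs <;> simp
  have hnorm : ∀ k, ‖T (u k)‖ ^ 2 = μ k := fun k => by
    rw [← real_inner_self_eq_norm_sq, hTT, if_pos rfl]
  have hanti : Antitone fun k => ‖T (u k)‖ := by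
    intro k l hkl
    have h1 : μ l ≤ μ k := hsym.eigenvalues_antitone hV hkl
    rw [← hnorm, ← hnorm] at h1
    exact (pow_le_pow_iff_left₀ (norm_nonneg _) (norm_nonneg _) two_ne_zero).1 h1
  -- Where `T (u k) = 0` this is `0`; such indices lie outside `s` and are filled in by extending to
  -- an orthonormal basis.
  let v : Fin r → V' := fun k => ‖T (u k)‖⁻¹ • T (u k)
  let s : Set (Fin r) := {k | ‖T (u k)‖ ≠ 0}
  have hv : Orthonormal ℝ (s.domRestrict v) := by
    rw [orthonormal_iff_ite]
    rintro ⟨k, hk⟩ ⟨l, hl⟩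
    have hk : ‖T (u k)‖ ≠ 0 := hk
    simp only [Set.domRestrict_apply, v, real_inner_smul_left, real_inner_smul_right, hTT,
      Subtype.mk.injEq]
    split_ifs with h
    · subst h
      rw [← hnorm]
      field_simp
    · simp
  obtain ⟨w, hw⟩ := hv.exists_orthonormalBasis_extension_of_card_eq (by simp [hV'])
  have hTw : ∀ k, T (u k) = ‖T (u k)‖ • w k := by
    intro k
    by_cases hk : ‖T (u k)‖ = 0
    · rw [hk, zero_smul]
      exact norm_eq_zero.1 hk
    · rw [hw k hk, smul_smul, mul_inv_cancel₀ hk, one_smul]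
  refine ⟨u, w, hanti, fun k l => ?_⟩
  calc ⟪T (u k), w l⟫_ℝ = ⟪‖T (u k)‖ • w k, w l⟫_ℝ := by rw [← hTw]
    _ = _ := by
      rw [real_inner_smul_left, orthonormal_iff_ite.1 w.orthonormal k l]
      split_ifs <;> simp

/-- Two subspaces of the same dimension have principal vectors with increasing angles. -/
theorem exists_isPrincipal_monotone (U W : Submodule ℝ (E n)) (hU : Module.finrank ℝ U = r)
    (hW : Module.finrank ℝ W = r) :
    ∃ (a b : Fin r → E n) (θ : Fin r → ℝ), IsPrincipal U W a b θ ∧ Monotone θ := by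
  -- Its singular values are the cosines of the principal angles; they are at most `1` because a
  -- projection does not increase norms.
  let T : U →ₗ[ℝ] W := W.orthogonalProjectionOnto.toLinearMap ∘ₗ U.subtype
  have hT : ∀ (x : U) (y : W), ⟪T x, y⟫_ℝ = ⟪(x : E n), (y : E n)⟫_ℝ := fun x y =>
    Submodule.inner_orthogonalProjectionOnto_eq_of_mem_right y (x : E n)
  have hTnorm : ∀ x : U, ‖T x‖ ≤ ‖x‖ := fun x =>
    W.norm_orthogonalProjectionOnto_apply_le (x : E n)
  obtain ⟨u, w, hanti, hTw⟩ := exists_orthonormalBasis_apply_eq_smul T hU hW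
  have hle : ∀ k, ‖T (u k)‖ ≤ 1 := fun k => (hTnorm (u k)).trans_eq (u.orthonormal.1 k)
  have hinner : ∀ k l, ⟪(u k : E n), (w l : E n)⟫_ℝ = if k = l then ‖T (u k)‖ else 0 :=
    fun k l => (hT _ _).symm.trans (hTw k l)
  have hspan : ∀ {V : Submodule ℝ (E n)} (e : OrthonormalBasis (Fin r) ℝ V),
      Submodule.span ℝ (Set.range fun k => (e k : E n)) = V := by
    intro V e
    have h1 := congrArg (Submodule.map V.subtype) e.toBasis.span_eq
    rw [Submodule.map_span, Submodule.map_top, Submodule.range_subtype, ← Set.range_comp] at h1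
    simpa [Function.comp_def] using h1
  have hcos : ∀ k, Real.cos (Real.arccos ‖T (u k)‖) = ‖T (u k)‖ := fun k =>
    Real.cos_arccos (by linarith [norm_nonneg (T (u k))]) (hle k)
  refine ⟨fun k => u k, fun k => w k, fun k => Real.arccos ‖T (u k)‖,
    ⟨u.orthonormal.comp_linearIsometry U.subtypeₗᵢ, w.orthonormal.comp_linearIsometry W.subtypeₗᵢ,
      hspan u, hspan w, fun k => ⟨Real.arccos_nonneg _,
        Real.arccos_le_pi_div_two.2 (norm_nonneg _)⟩, fun k => ?_, fun k l hkl => ?_⟩,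
    fun k l hkl => Real.arccos_le_arccos (hanti hkl)⟩
  · rw [hcos, hinner, if_pos rfl]
  · rw [hinner, if_neg hkl]

theorem mem_iff_lt_card_of_isLowerSet (S : Finset (Fin r)) (h : IsLowerSet (S : Set (Fin r)))
    (k : Fin r) : k ∈ S ↔ (k : ℕ) < S.card := by
  constructor
  · intro hk
    have h1 : Finset.Iic k ⊆ S := fun l hl => h (Finset.mem_Iic.1 hl) hk
    have h2 := Finset.card_le_card h1
    rw [Fin.card_Iic] at h2
    omega
  · intro hk
    by_contra hkS
    have h1 : S ⊆ Finset.Iio k := fun l hl =>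
      Finset.mem_Iio.2 (lt_of_not_ge fun hkl => hkS (h hkl hl))
    have h2 := Finset.card_le_card h1
    rw [Fin.card_Iio] at h2
    omega

/-- By monotonicity the angles `0` form an initial segment and the angles `π/2` a final one; `s` and
`t` are their sizes. -/
theorem exists_isArranged {θ : Fin r → ℝ} (hmem : ∀ k, θ k ∈ Set.Icc 0 (Real.pi / 2))
    (hθ : Monotone θ) : ∃ s t, IsArranged s t θ := by
  classical
  have h0 : IsLowerSet ((Finset.univ.filter fun k => θ k = 0 : Finset (Fin r)) : Set (Fin r)) := by
    intro k l hlk hk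
    simp only [Finset.coe_filter, Finset.mem_univ, true_and, Set.mem_ofPred_eq] at hk ⊢
    exact le_antisymm (hk ▸ hθ hlk) (hmem l).1
  have h1 : IsLowerSet
      ((Finset.univ.filter fun k => θ k = Real.pi / 2 : Finset (Fin r))ᶜ : Set (Fin r)) := by
    intro k l hlk hk
    simp only [Finset.coe_filter, Finset.mem_univ, true_and, Set.mem_compl_iff,
      Set.mem_ofPred_eq] at hk ⊢
    exact fun hl => hk (le_antisymm (hmem k).2 (hl ▸ hθ hlk))
  refine ⟨(Finset.univ.filter fun k => θ k = 0).card,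
    (Finset.univ.filter fun k => θ k = Real.pi / 2).card, ?_, fun k => ?_, fun k => ?_⟩
  · rw [← Finset.card_union_of_disjoint]
    · exact (Finset.card_le_univ _).trans_eq (Fintype.card_fin r)
    · rw [Finset.disjoint_filter]
      intro k _ hk
      rw [hk]
      exact (by positivity : (0 : ℝ) < Real.pi / 2).ne
  · rw [← mem_iff_lt_card_of_isLowerSet _ h0]
    simp
  · rw [← Finset.coe_compl] at h1
    have h2 := mem_iff_lt_card_of_isLowerSet _ h1 k
    rw [Finset.card_compl, Fintype.card_fin, Finset.mem_compl, Finset.mem_filter] at h2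
    simp only [Finset.mem_univ, true_and] at h2
    rw [← not_lt, ← h2, not_not]

variable {U W : Submodule ℝ (E n)} {a b : Fin r → E n} {θ : Fin r → ℝ} {s t : ℕ}

theorem IsPrincipal.inner_eq_ite (h : IsPrincipal U W a b θ) (k l : Fin r) :
    ⟪a k, b l⟫_ℝ = if k = l then Real.cos (θ k) else 0 := by
  split_ifs with hkl
  · rw [← hkl, h.inner_same]
  · exact h.inner_ne k l hkl

theorem IsPrincipal.cos_eq_one_iff (h : IsPrincipal U W a b θ) (k : Fin r) :
    Real.cos (θ k) = 1 ↔ θ k = 0 := by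
  have := h.angle_mem k
  exact Real.cos_eq_one_iff_of_lt_of_lt (by linarith [this.1, Real.pi_pos])
    (by linarith [this.2, Real.pi_pos])

theorem IsPrincipal.left_eq_right (h : IsPrincipal U W a b θ) {k : Fin r} (hk : θ k = 0) :
    a k = b k := by
  rw [← inner_eq_one_iff_of_norm_eq_one (𝕜 := ℝ) (h.orthonormal_left.1 k)
    (h.orthonormal_right.1 k), h.inner_same, hk, Real.cos_zero]

/-- Let `x` in both subspaces have coordinates `c` in `a` and `d` in `b`. Pairing `x` with the
opposite basis gives `c k = d k cos θ_k` and `d k = c k cos θ_k`. So `c k (1 - cos² θ_k) = 0`, and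
only indices with angle `0` contribute. -/
theorem IsPrincipal.finrank_inf (h : IsPrincipal U W a b θ) (hst : IsArranged s t θ) :
    Module.finrank ℝ (U ⊓ W : Submodule ℝ (E n)) = s := by
  have hs : s ≤ r := by have := hst.add_le; omega
  have hspan : Submodule.span ℝ (Set.range (a ∘ Fin.castLE hs)) = U ⊓ W := by
    apply le_antisymm
    · rw [Submodule.span_le]
      rintro _ ⟨k, rfl⟩
      refine ⟨h.span_left ▸ Submodule.subset_span ⟨_, rfl⟩, ?_⟩
      have h0 : θ (Fin.castLE hs k) = 0 := (hst.eq_zero_iff _).2 k.2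
      rw [Function.comp_apply, h.left_eq_right h0]
      exact h.span_right ▸ Submodule.subset_span ⟨_, rfl⟩
    · rintro x ⟨hxU, hxW⟩
      have hxU : x ∈ U := hxU
      have hxW : x ∈ W := hxW
      rw [← h.span_left] at hxU
      rw [← h.span_right] at hxW
      obtain ⟨c, hc⟩ := (Submodule.mem_span_range_iff_exists_fun ℝ).1 hxU
      obtain ⟨d, hd⟩ := (Submodule.mem_span_range_iff_exists_fun ℝ).1 hxW
      have hac : ∀ k, ⟪a k, x⟫_ℝ = c k := fun k => by
        rw [← hc, inner_sum]
        simp [real_inner_smul_right, orthonormal_iff_ite.1 h.orthonormal_left]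
      have hbd : ∀ k, ⟪x, b k⟫_ℝ = d k := fun k => by
        rw [← hd, sum_inner]
        simp [real_inner_smul_left, orthonormal_iff_ite.1 h.orthonormal_right]
      have had : ∀ k, ⟪a k, x⟫_ℝ = d k * Real.cos (θ k) := fun k => by
        rw [← hd, inner_sum]
        simp [real_inner_smul_right, h.inner_eq_ite]
      have hbc : ∀ k, ⟪x, b k⟫_ℝ = c k * Real.cos (θ k) := fun k => by
        rw [← hc, sum_inner]
        simp [real_inner_smul_left, h.inner_eq_ite]
      rw [← hc]
      refine Submodule.sum_mem _ fun k _ => ?_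
      by_cases hk : (k : ℕ) < s
      · exact Submodule.smul_mem _ _ (Submodule.subset_span ⟨⟨k, hk⟩, rfl⟩)
      · have h1 : c k = c k * Real.cos (θ k) * Real.cos (θ k) := by
          rw [← hbc, hbd, ← had, hac]
        have h2 : Real.cos (θ k) ≠ 1 := by
          rw [Ne, h.cos_eq_one_iff, hst.eq_zero_iff]
          exact hk
        have h3 : 0 ≤ Real.cos (θ k) := Real.cos_nonneg_of_mem_Icc
          ⟨by linarith [(h.angle_mem k).1, Real.pi_pos], (h.angle_mem k).2⟩
        have h4 : c k * ((1 - Real.cos (θ k)) * (1 + Real.cos (θ k))) = 0 := by linarith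
        have h5 : c k = 0 := by
          rcases mul_eq_zero.1 h4 with h5 | h5
          · exact h5
          · rcases mul_eq_zero.1 h5 with h6 | h6
            · exact absurd (by linarith) h2
            · linarith
        rw [h5, zero_smul]
        exact Submodule.zero_mem _
  rw [← hspan, finrank_span_eq_card
    (h.orthonormal_left.linearIndependent.comp _ (Fin.castLE_injective hs)), Fintype.card_fin]

end GA

/-! ### Ordered products of commuting elements and their grade parts. -/

namespace GA

universe u

variable {n r : ℕ}

/-- Commuting elements of an algebra come from a commutative algebra. -/
theorem exists_commRing_algHom {ι : Type*} {A : Type u} [Ring A] [Algebra ℝ A] (i : ι → A)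
    (h : ∀ k l, Commute (i k) (i l)) :
    ∃ (K : Type u) (_ : CommRing K) (_ : Algebra ℝ K) (φ : K →ₐ[ℝ] A) (g : ι → K),
      i = fun k => φ (g k) := by
  have hcomm : ∀ x ∈ Set.range i, ∀ y ∈ Set.range i, x * y = y * x := by
    rintro _ ⟨k, rfl⟩ _ ⟨l, rfl⟩
    exact h k l
  have := Algebra.isMulCommutative_adjoin ℝ hcomm
  let : CommRing (Algebra.adjoin ℝ (Set.range i)) :=
    { (Algebra.adjoin ℝ (Set.range i)).toRing with mul_comm := mul_comm' }
  exact ⟨Algebra.adjoin ℝ (Set.range i), inferInstance, inferInstance, Subalgebra.val _,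
    fun k => ⟨i k, Algebra.subset_adjoin ⟨k, rfl⟩⟩, rfl⟩

/-- Once commuting elements are lifted to a commutative ring, ordered products become `Finset`
products, for which the usual product identities hold. -/
theorem oprod_algHom {K : Type*} [CommRing K] [Algebra ℝ K] (φ : K →ₐ[ℝ] Cl n)
    (S : Finset (Fin r)) (g : Fin r → K) :
    oprod S (fun k => φ (g k)) = φ (∏ k ∈ S, g k) := by
  have h1 : ∏ k ∈ S, g k = (S.sort.map g).prod := by
    rw [Finset.prod, ← Multiset.prod_coe, ← Multiset.map_coe, Finset.sort_eq]
  rw [h1, map_list_prod, List.map_map]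
  rfl

theorem oprod_empty (f : Fin r → Cl n) : oprod ∅ f = 1 := by simp [oprod]

theorem oprod_singleton (f : Fin r → Cl n) (k : Fin r) : oprod {k} f = f k := by simp [oprod]

theorem oprod_union {i : Fin r → Cl n} (h : ∀ k l, Commute (i k) (i l)) {S T : Finset (Fin r)}
    (hST : Disjoint S T) : oprod (S ∪ T) i = oprod S i * oprod T i := by
  obtain ⟨K, _, _, φ, g, rfl⟩ := exists_commRing_algHom i h
  rw [oprod_algHom, oprod_algHom, oprod_algHom, Finset.prod_union hST, map_mul]

theorem isUnit_oprod {f : Fin r → Cl n} {S : Finset (Fin r)} (h : ∀ k ∈ S, IsUnit (f k)) :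
    IsUnit (oprod S f) := by
  refine List.prod_isUnit fun x hx => ?_
  obtain ⟨k, hk, rfl⟩ := List.mem_map.1 hx
  exact h k ((Finset.mem_sort _).1 hk)

/-- The rotor in the plane `i` with the angle `θ`. -/
noncomputable def rotor (θ : ℝ) (i : Cl n) : Cl n :=
  algebraMap ℝ (Cl n) (Real.cos θ) + Real.sin θ • i

theorem commute_oprod_rotor_oprod {i : Fin r → Cl n} (h : ∀ k l, Commute (i k) (i l))
    (θ : Fin r → ℝ) (S T : Finset (Fin r)) :
    Commute (oprod S fun k => rotor (θ k) (i k)) (oprod T i) := by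
  obtain ⟨K, _, _, φ, g, rfl⟩ := exists_commRing_algHom i h
  have h1 : (fun k => rotor (θ k) (φ (g k))) =
      fun k => φ (algebraMap ℝ K (Real.cos (θ k)) + Real.sin (θ k) • g k) := by
    simp [rotor]
  rw [h1, oprod_algHom, oprod_algHom]
  exact (Commute.all _ _).map φ

theorem oprod_rotor_eq_sum {i : Fin r → Cl n} (h : ∀ k l, Commute (i k) (i l))
    (θ : Fin r → ℝ) (m : Finset (Fin r)) :
    oprod m (fun k => rotor (θ k) (i k)) = ∑ S ∈ m.powerset,
      ((∏ k ∈ S, Real.sin (θ k)) * ∏ k ∈ m \ S, Real.cos (θ k)) • oprod S i := by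
  obtain ⟨K, _, _, φ, g, rfl⟩ := exists_commRing_algHom i h
  have h1 : (fun k => rotor (θ k) (φ (g k))) =
      fun k => φ (Real.sin (θ k) • g k + algebraMap ℝ K (Real.cos (θ k))) := by
    simp [rotor, add_comm]
  rw [h1, oprod_algHom, Finset.prod_add, map_sum]
  refine Finset.sum_congr rfl fun S _ => ?_
  rw [oprod_algHom, ← map_smul, ← map_prod, Finset.prod_smul, mul_comm, ← Algebra.smul_def,
    smul_smul, mul_comm]

theorem card_last {r t : ℕ} (h : t ≤ r) : (last r t).card = t := by
  have h1 : last r t = (Finset.univ.filter fun k : Fin r => (k : ℕ) < r - t)ᶜ := by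
    ext k
    simp [last]
  rw [h1, Finset.card_compl, Fin.card_filter_val_lt, Fintype.card_fin]
  omega

theorem disjoint_mid_last (r s t : ℕ) : Disjoint (mid r s t) (last r t) := by
  rw [Finset.disjoint_left]
  intro k h1 h2
  simp only [mid, last, Finset.mem_filter, Finset.mem_univ, true_and] at h1 h2
  omega

theorem card_mid {r s t : ℕ} (h : s + t ≤ r) : (mid r s t).card = r - s - t := by
  have h1 : mid r s t ∪ last r t = last r (r - s) := by
    ext k
    simp only [mid, last, Finset.mem_union, Finset.mem_filter, Finset.mem_univ, true_and]
    omega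
  have h2 := Finset.card_union_of_disjoint (disjoint_mid_last r s t)
  rw [h1, card_last (by omega), card_last (by omega)] at h2
  omega

/-- The rotor of angle `0` is `1` and that of angle `π/2` is `i k`. -/
theorem oprod_univ_rotor {i : Fin r → Cl n} (h : ∀ k l, Commute (i k) (i l))
    {θ : Fin r → ℝ} {s t : ℕ} (hst : IsArranged s t θ) :
    oprod Finset.univ (fun k => rotor (θ k) (i k)) =
      oprod (mid r s t) (fun k => rotor (θ k) (i k)) * oprod (last r t) i := by
  obtain ⟨K, _, _, φ, g, rfl⟩ := exists_commRing_algHom i h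
  have h1 : (fun k => rotor (θ k) (φ (g k))) =
      fun k => φ (algebraMap ℝ K (Real.cos (θ k)) + Real.sin (θ k) • g k) := by
    simp [rotor]
  have h2 : ∏ k ∈ last r t, g k =
      ∏ k ∈ last r t, (algebraMap ℝ K (Real.cos (θ k)) + Real.sin (θ k) • g k) := by
    refine Finset.prod_congr rfl fun k hk => ?_
    rw [(hst.eq_pi_div_two_iff k).2 (by simpa [last] using hk)]
    simp
  rw [h1, oprod_algHom, oprod_algHom, oprod_algHom, ← map_mul, h2,
    ← Finset.prod_union (disjoint_mid_last r s t)]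
  congr 1
  refine (Finset.prod_subset (Finset.subset_univ _) fun k _ hk => ?_).symm
  rw [(hst.eq_zero_iff k).2 ?_]
  · simp
  · simp only [mid, last, Finset.mem_union, Finset.mem_filter, Finset.mem_univ, true_and] at hk
    omega

/-- Each term is homogeneous, so a grade part just selects terms. Both `M` (up to sign, with `T` =
`last r t`) and `D` (with `T = ∅`) have this form. -/
theorem gradePart_sum_smul_oprod {i : Fin r → Cl n}
    (hi : ∀ S : Finset (Fin r), IsKVector (2 * S.card) (oprod S i))
    (κ : Finset (Fin r) → ℝ) {m T : Finset (Fin r)} (hmT : Disjoint m T) (j : ℕ) :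
    gradePart j (∑ S ∈ m.powerset, κ S • oprod (S ∪ T) i) =
      ∑ S ∈ m.powerset, if j = 2 * (S.card + T.card) then κ S • oprod (S ∪ T) i else 0 := by
  rw [gradePart_sum]
  refine Finset.sum_congr rfl fun S hS => ?_
  rw [gradePart_smul, (hi _).gradePart_eq, Finset.card_union_of_disjoint
    (hmT.mono_left (Finset.mem_powerset.1 hS)), smul_ite, smul_zero]

theorem gradePart_sum_smul_oprod_of_lt {i : Fin r → Cl n}
    (hi : ∀ S : Finset (Fin r), IsKVector (2 * S.card) (oprod S i))
    (κ : Finset (Fin r) → ℝ) {m T : Finset (Fin r)} (hmT : Disjoint m T) {j : ℕ}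
    (hj : j < 2 * T.card) : gradePart j (∑ S ∈ m.powerset, κ S • oprod (S ∪ T) i) = 0 := by
  rw [gradePart_sum_smul_oprod hi κ hmT]
  exact Finset.sum_eq_zero fun S _ => if_neg (by omega)

theorem gradePart_sum_smul_oprod_of_gt {i : Fin r → Cl n}
    (hi : ∀ S : Finset (Fin r), IsKVector (2 * S.card) (oprod S i))
    (κ : Finset (Fin r) → ℝ) {m T : Finset (Fin r)} (hmT : Disjoint m T) {j : ℕ}
    (hj : 2 * (m.card + T.card) < j) :
    gradePart j (∑ S ∈ m.powerset, κ S • oprod (S ∪ T) i) = 0 := by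
  rw [gradePart_sum_smul_oprod hi κ hmT]
  refine Finset.sum_eq_zero fun S hS => if_neg ?_
  have := Finset.card_le_card (Finset.mem_powerset.1 hS)
  omega

theorem gradePart_sum_smul_oprod_lowest {i : Fin r → Cl n}
    (hi : ∀ S : Finset (Fin r), IsKVector (2 * S.card) (oprod S i))
    (κ : Finset (Fin r) → ℝ) {m T : Finset (Fin r)} (hmT : Disjoint m T) :
    gradePart (2 * T.card) (∑ S ∈ m.powerset, κ S • oprod (S ∪ T) i) = κ ∅ • oprod T i := by
  rw [gradePart_sum_smul_oprod hi κ hmT, Finset.sum_eq_single ∅]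
  · simp
  · intro S _ hS
    have := Finset.card_pos.2 (Finset.nonempty_iff_ne_empty.2 hS)
    exact if_neg (by omega)
  · simp

theorem gradePart_sum_smul_oprod_highest {i : Fin r → Cl n}
    (hi : ∀ S : Finset (Fin r), IsKVector (2 * S.card) (oprod S i))
    (κ : Finset (Fin r) → ℝ) {m T : Finset (Fin r)} (hmT : Disjoint m T) :
    gradePart (2 * (m.card + T.card)) (∑ S ∈ m.powerset, κ S • oprod (S ∪ T) i) =
      κ m • oprod (m ∪ T) i := by
  rw [gradePart_sum_smul_oprod hi κ hmT, Finset.sum_eq_single m]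
  · simp
  · intro S hS hSm
    have := Finset.card_lt_card
      (Finset.ssubset_iff_subset_ne.2 ⟨Finset.mem_powerset.1 hS, hSm⟩)
    exact if_neg (by omega)
  · simp

theorem gradePart_two_sum_smul_oprod {i : Fin r → Cl n}
    (hi : ∀ S : Finset (Fin r), IsKVector (2 * S.card) (oprod S i))
    (κ : Finset (Fin r) → ℝ) (m : Finset (Fin r)) :
    gradePart 2 (∑ S ∈ m.powerset, κ S • oprod (S ∪ ∅) i) = ∑ k ∈ m, κ {k} • i k := by
  rw [gradePart_sum_smul_oprod hi κ (Finset.disjoint_empty_right m), ← Finset.sum_filter]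
  have h1 : (m.powerset.filter fun S => 2 = 2 * (S.card + (∅ : Finset (Fin r)).card)) =
      m.powersetCard 1 := by
    rw [Finset.powersetCard_eq_filter]
    refine Finset.filter_congr fun S _ => ?_
    rw [Finset.card_empty]
    omega
  rw [h1, Finset.powersetCard_one, Finset.sum_map]
  refine Finset.sum_congr rfl fun k _ => ?_
  simp [oprod_singleton]

end GA

/-! ### The principal planes and their unit bivectors. -/

namespace GA

variable {n r : ℕ} {U W : Submodule ℝ (E n)} {a b : Fin r → E n} {θ : Fin r → ℝ} {s t : ℕ}

/-- The unit vector orthogonal to `a` in the plane of two unit vectors `a`, `b` with the angle `θ`;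
it is `0` if `sin θ = 0`. -/
noncomputable def normalVec (a b : E n) (θ : ℝ) : E n :=
  (Real.sin θ)⁻¹ • (b - Real.cos θ • a)

theorem IsPrincipal.sin_pos (h : IsPrincipal U W a b θ) {k : Fin r} (hk : θ k ≠ 0) :
    0 < Real.sin (θ k) :=
  Real.sin_pos_of_pos_of_lt_pi (lt_of_le_of_ne (h.angle_mem k).1 hk.symm)
    (by linarith [(h.angle_mem k).2, Real.pi_pos])

theorem IsPrincipal.cos_pos (h : IsPrincipal U W a b θ) {k : Fin r} (hk : θ k ≠ Real.pi / 2) :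
    0 < Real.cos (θ k) :=
  Real.cos_pos_of_mem_Ioo ⟨by linarith [(h.angle_mem k).1, Real.pi_pos],
    lt_of_le_of_ne (h.angle_mem k).2 hk⟩

/-- For angle `0` the normal vector is `0`, as `0⁻¹ = 0`, and the two principal vectors coincide. -/
theorem IsPrincipal.right_eq (h : IsPrincipal U W a b θ) (k : Fin r) :
    b k = Real.cos (θ k) • a k + Real.sin (θ k) • normalVec (a k) (b k) (θ k) := by
  by_cases hk : θ k = 0
  · rw [h.left_eq_right hk, hk]
    simp
  · rw [normalVec, smul_smul, mul_inv_cancel₀ (h.sin_pos hk).ne', one_smul]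
    abel

theorem IsPrincipal.inner_left_normalVec (h : IsPrincipal U W a b θ) (k l : Fin r) :
    ⟪a k, normalVec (a l) (b l) (θ l)⟫_ℝ = 0 := by
  rw [normalVec, real_inner_smul_right, inner_sub_right, real_inner_smul_right, h.inner_eq_ite,
    orthonormal_iff_ite.1 h.orthonormal_left k l]
  split_ifs with hkl
  · simp [hkl]
  · simp

theorem IsPrincipal.inner_normalVec (h : IsPrincipal U W a b θ) {k l : Fin r} (hkl : k ≠ l) :
    ⟪normalVec (a k) (b k) (θ k), normalVec (a l) (b l) (θ l)⟫_ℝ = 0 := by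
  rw [normalVec, real_inner_smul_left, inner_sub_left, real_inner_smul_left,
    h.inner_left_normalVec, normalVec, real_inner_smul_right, inner_sub_right,
    real_inner_smul_right, h.orthonormal_right.2 hkl, real_inner_comm, h.inner_ne l k hkl.symm]
  simp

theorem IsPrincipal.norm_normalVec (h : IsPrincipal U W a b θ) {k : Fin r} (hk : θ k ≠ 0) :
    ‖normalVec (a k) (b k) (θ k)‖ = 1 := by
  have hs := h.sin_pos hk
  have h1 : ‖b k - Real.cos (θ k) • a k‖ ^ 2 = Real.sin (θ k) ^ 2 := by
    rw [norm_sub_sq_real, real_inner_smul_right, real_inner_comm, h.inner_same, norm_smul,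
      h.orthonormal_left.1, h.orthonormal_right.1, Real.sin_sq, Real.norm_eq_abs, mul_one, sq_abs]
    ring
  rw [normalVec, norm_smul, norm_inv, Real.norm_of_nonneg hs.le,
    (pow_left_inj₀ (norm_nonneg _) hs.le two_ne_zero).1 h1, inv_mul_cancel₀ hs.ne']

/-- The part of `b k` along `a k` drops out of the outer product, leaving `sin θ_k` times a product
of two orthogonal vectors. For angle `0` both sides vanish. -/
theorem IsPrincipal.unitBivector_eq (h : IsPrincipal U W a b θ) (k : Fin r) :
    unitBivector (a k) (b k) = vec (a k) * vec (normalVec (a k) (b k) (θ k)) := by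
  set f := normalVec (a k) (b k) (θ k) with hf
  have haf : ⟪a k, f⟫_ℝ = 0 := h.inner_left_normalVec k k
  have hpw : [a k, f].Pairwise fun x y => ⟪x, y⟫_ℝ = 0 := by simpa using haf
  have h1 : wedge ![a k, b k] = Real.sin (θ k) • (vec (a k) * vec f) := by
    rw [wedge, LinearEquiv.symm_apply_eq, map_smul]
    have h2 := toExt_list_prod _ hpw
    simp only [List.map_cons, List.map_nil, List.prod_cons, List.prod_nil, mul_one] at h2
    rw [h2, h.right_eq k, ← hf, ExteriorAlgebra.ιMulti_apply]
    simp [mul_add]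
  unfold unitBivector
  rw [h1]
  by_cases hk : θ k = 0
  · rw [hf, normalVec, hk]
    simp
  · have hs := h.sin_pos hk
    have h3 := list_prod_mul_reverse [a k, f] (by
      simpa using ⟨h.orthonormal_left.1 k, h.norm_normalVec hk⟩)
    simp only [List.map_cons, List.map_nil, List.prod_cons, List.prod_nil, mul_one] at h3
    rw [modulus_smul_of_mul_reverse_eq_one h3, abs_of_pos hs, smul_smul, inv_mul_cancel₀ hs.ne',
      one_smul]

theorem IsPrincipal.vec_mul_vec (h : IsPrincipal U W a b θ) (k : Fin r) :
    vec (a k) * vec (b k) = rotor (θ k) (unitBivector (a k) (b k)) := by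
  rw [h.unitBivector_eq]
  conv_lhs => rw [h.right_eq k]
  rw [vec, vec, map_add, map_smul, map_smul, mul_add, mul_smul_comm, mul_smul_comm, vec_mul_self,
    real_inner_self_eq_norm_sq, h.orthonormal_left.1, rotor, one_pow, map_one,
    Algebra.algebraMap_eq_smul_one]

/-- The vectors `a k` and the normal vectors, for the indices in a list. -/
noncomputable def planeVecs (a b : Fin r → E n) (θ : Fin r → ℝ) (l : List (Fin r)) : List (E n) :=
  l.flatMap fun k => [a k, normalVec (a k) (b k) (θ k)]

theorem IsPrincipal.map_planeVecs_prod (h : IsPrincipal U W a b θ) (l : List (Fin r)) :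
    ((planeVecs a b θ l).map vec).prod = (l.map fun k => unitBivector (a k) (b k)).prod := by
  induction l with
  | nil => rfl
  | cons k l ih =>
    rw [planeVecs] at ih ⊢
    simp only [List.flatMap_cons, List.map_append, List.prod_append, List.map_cons, List.prod_cons,
      ih, h.unitBivector_eq k]
    simp

theorem IsPrincipal.pairwise_planeVecs (h : IsPrincipal U W a b θ) {l : List (Fin r)}
    (hl : l.Nodup) : (planeVecs a b θ l).Pairwise fun x y => ⟪x, y⟫_ℝ = 0 := by
  rw [planeVecs, List.pairwise_flatMap]
  refine ⟨fun k _ => by simpa using h.inner_left_normalVec k k, hl.imp fun {k l} hkl => ?_⟩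
  have h1 : ⟪normalVec (a k) (b k) (θ k), a l⟫_ℝ = 0 := by
    rw [real_inner_comm]
    exact h.inner_left_normalVec l k
  simp [h.orthonormal_left.2 hkl, h.inner_left_normalVec, h.inner_normalVec hkl, h1]

theorem IsPrincipal.isKVector_oprod (h : IsPrincipal U W a b θ) (S : Finset (Fin r)) :
    IsKVector (2 * S.card) (oprod S fun k => unitBivector (a k) (b k)) := by
  have h1 := isKVector_list_prod _ (h.pairwise_planeVecs (S.sort_nodup (· ≤ ·)))
  rw [h.map_planeVecs_prod] at h1
  have h2 : (planeVecs a b θ S.sort).length = 2 * S.card := by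
    simp [planeVecs, List.length_flatMap, mul_comm]
  rwa [h2] at h1

theorem IsPrincipal.oprod_mul_reverse (h : IsPrincipal U W a b θ) {S : Finset (Fin r)}
    (hS : ∀ k ∈ S, θ k ≠ 0) :
    oprod S (fun k => unitBivector (a k) (b k)) *
      CliffordAlgebra.reverse (oprod S fun k => unitBivector (a k) (b k)) = 1 := by
  have h1 := list_prod_mul_reverse (planeVecs a b θ S.sort) (by
    intro x hx
    rw [planeVecs, List.mem_flatMap] at hx
    obtain ⟨k, hk, hx⟩ := hx
    have hk := hS k ((Finset.mem_sort _).1 hk)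
    simp only [List.mem_cons, List.not_mem_nil, or_false] at hx
    rcases hx with rfl | rfl
    · exact h.orthonormal_left.1 k
    · exact h.norm_normalVec hk)
  rwa [h.map_planeVecs_prod] at h1

theorem IsPrincipal.unitBivector_mul_self (h : IsPrincipal U W a b θ) {k : Fin r} (hk : θ k ≠ 0) :
    unitBivector (a k) (b k) * unitBivector (a k) (b k) = -1 := by
  rw [h.unitBivector_eq]
  nth_rw 2 [vec_mul_vec_of_inner_eq_zero (h.inner_left_normalVec k k)]
  rw [mul_neg, mul_assoc, ← mul_assoc _ _ (vec (a k)), vec_mul_self (normalVec _ _ _),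
    real_inner_self_eq_norm_sq, h.norm_normalVec hk, one_pow, map_one, one_mul, vec_mul_self,
    real_inner_self_eq_norm_sq, h.orthonormal_left.1, one_pow, map_one]

/-- Passing `x` across `y` and `z` costs two signs. -/
theorem commute_vec_mul_vec {x y z : E n} (hy : ⟪x, y⟫_ℝ = 0) (hz : ⟪x, z⟫_ℝ = 0) :
    Commute (vec x) (vec y * vec z) := by
  rw [Commute, SemiconjBy, ← mul_assoc, vec_mul_vec_of_inner_eq_zero hy, neg_mul, mul_assoc,
    vec_mul_vec_of_inner_eq_zero hz, mul_neg, neg_neg, mul_assoc]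

theorem IsPrincipal.commute_unitBivector (h : IsPrincipal U W a b θ) (k l : Fin r) :
    Commute (unitBivector (a k) (b k)) (unitBivector (a l) (b l)) := by
  by_cases hkl : k = l
  · rw [hkl]
  · rw [h.unitBivector_eq k, h.unitBivector_eq l]
    refine Commute.mul_left
      (commute_vec_mul_vec (h.orthonormal_left.2 hkl) (h.inner_left_normalVec k l))
      (commute_vec_mul_vec ?_ (h.inner_normalVec hkl))
    rw [real_inner_comm]
    exact h.inner_left_normalVec l k

/-- Reversal nests the factors as `a_k (⋯) b_k`. Since `b_k` is orthogonal to every inner `a_j` and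
`b_j`, it commutes with the inner product of the `a_j b_j` and can move next to `a_k`. -/
theorem IsPrincipal.list_prod_mul_reverse (h : IsPrincipal U W a b θ) {l : List (Fin r)}
    (hl : l.Nodup) :
    (l.map fun k => vec (a k)).prod * CliffordAlgebra.reverse (l.map fun k => vec (b k)).prod =
      (l.map fun k => vec (a k) * vec (b k)).prod := by
  induction l with
  | nil => simp
  | cons k l ih =>
    rw [List.nodup_cons] at hl
    have hcomm : Commute (vec (b k)) (l.map fun k => vec (a k) * vec (b k)).prod := by
      refine Commute.list_prod_right _ _ fun x hx => ?_
      obtain ⟨j, hj, rfl⟩ := List.mem_map.1 hx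
      have hkj : k ≠ j := fun hkj => hl.1 (hkj ▸ hj)
      refine commute_vec_mul_vec ?_ (h.orthonormal_right.2 hkj)
      rw [real_inner_comm]
      exact h.inner_ne j k hkj.symm
    simp only [List.map_cons, List.prod_cons, CliffordAlgebra.reverse.map_mul,
      CliffordAlgebra.reverse_ι]
    rw [mul_assoc, ← mul_assoc _ _ (vec (b k)), ih hl.2, ← hcomm.eq, mul_assoc]

theorem IsPrincipal.oprod_vec_mul_reverse (h : IsPrincipal U W a b θ) :
    oprod Finset.univ (fun k => vec (a k)) *
        CliffordAlgebra.reverse (oprod Finset.univ fun k => vec (b k)) =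
      oprod Finset.univ fun k => rotor (θ k) (unitBivector (a k) (b k)) := by
  simp only [← h.vec_mul_vec]
  exact h.list_prod_mul_reverse (Finset.sort_nodup _ _)

end GA

/-! ### Extreme grades of the normed product, and division by its lowest part. -/

theorem mainTheorem2 (n r : ℕ) (U W : Submodule ℝ (GA.E n))
    (hU : Module.finrank ℝ U = r) (hW : Module.finrank ℝ W = r) :
    -- principal vectors with suitably arranged principal angles exist
    (∃ (s t : ℕ) (a b : Fin r → GA.E n) (θ : Fin r → ℝ),
      GA.IsPrincipal U W a b θ ∧ GA.IsArranged s t θ) ∧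
    -- and for every choice of them and of blades representing the subspaces:
    ∀ (s t : ℕ) (a b : Fin r → GA.E n) (θ : Fin r → ℝ),
      GA.IsPrincipal U W a b θ → GA.IsArranged s t θ →
      ∀ A B : GA.Cl n, GA.IsBladeOf r U A → GA.IsBladeOf r W B →
      ∀ (i : Fin r → GA.Cl n), (∀ k, i k = GA.unitBivector (a k) (b k)) →
      ∀ (M L D : GA.Cl n), M = GA.normedProduct A B → L = GA.gradePart (2 * t) M →
        D = M * Ring.inverse L →
      -- `s` is the dimension of the intersection
      Module.finrank ℝ (U ⊓ W : Submodule ℝ (GA.E n)) = s ∧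
      -- the principal plane bivectors
      (∀ k, GA.vec (a k) * GA.vec (b k) =
        algebraMap ℝ (GA.Cl n) (Real.cos (θ k)) + Real.sin (θ k) • i k) ∧
      (∀ k : Fin r, s ≤ (k : ℕ) → i k * i k = -1) ∧
      (∀ k l, Commute (i k) (i l)) ∧
      -- `εA`, `εB` compare the orientations of the blades with those of the principal vectors
      ∃ εA εB ε : ℝ, (εA = 1 ∨ εA = -1) ∧ (εB = 1 ∨ εB = -1) ∧ ε = εA * εB ∧
        A = (εA * GA.modulus A) • GA.oprod Finset.univ (fun k => GA.vec (a k)) ∧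
        B = (εB * GA.modulus B) • GA.oprod Finset.univ (fun k => GA.vec (b k)) ∧
        -- the normed product as a product of rotors, and its expansion
        M = ε • (GA.oprod (GA.mid r s t)
            (fun k => algebraMap ℝ (GA.Cl n) (Real.cos (θ k)) + Real.sin (θ k) • i k) *
          GA.oprod (GA.last r t) i) ∧
        M = ε • ((∑ S ∈ (GA.mid r s t).powerset,
            ((∏ k ∈ S, Real.sin (θ k)) * ∏ k ∈ GA.mid r s t \ S, Real.cos (θ k)) •
              GA.oprod S i) * GA.oprod (GA.last r t) i) ∧
        -- the lowest non-zero grade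
        (∀ j < 2 * t, GA.gradePart j M = 0) ∧
        L ≠ 0 ∧
        L = (ε * ∏ k ∈ GA.mid r s t, Real.cos (θ k)) • GA.oprod (GA.last r t) i ∧
        GA.modulus L = ∏ k ∈ GA.mid r s t, Real.cos (θ k) ∧
        -- the highest non-zero grade
        (∀ j > 2 * (r - s), GA.gradePart j M = 0) ∧
        GA.gradePart (2 * (r - s)) M ≠ 0 ∧
        GA.gradePart (2 * (r - s)) M = (ε * ∏ k ∈ GA.mid r s t, Real.sin (θ k)) •
          (GA.oprod (GA.mid r s t) i * GA.oprod (GA.last r t) i) ∧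
        GA.modulus (GA.gradePart (2 * (r - s)) M) = ∏ k ∈ GA.mid r s t, Real.sin (θ k) ∧
        -- division by the lowest-grade part (on either side)
        IsUnit L ∧
        D = Ring.inverse L * M ∧
        (∀ j > 2 * (r - s - t), GA.gradePart j D = 0) ∧
        GA.gradePart (2 * (r - s - t)) D ≠ 0 ∧
        GA.gradePart 0 D = 1 ∧
        GA.gradePart 2 D = ∑ k ∈ GA.mid r s t, Real.tan (θ k) • i k := by
  refine ⟨?_, ?_⟩
  · obtain ⟨a, b, θ, h, hθ⟩ := GA.exists_isPrincipal_monotone U W hU hW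
    obtain ⟨s, t, hst⟩ := GA.exists_isArranged h.angle_mem hθ
    exact ⟨s, t, a, b, θ, h, hst⟩
  intro s t a b θ h hst A B hA hB i hi M L D hM hL hD
  obtain rfl : i = fun k => GA.unitBivector (a k) (b k) := funext hi
  set i : Fin r → GA.Cl n := fun k => GA.unitBivector (a k) (b k)
  obtain ⟨εA, hεA, hA0, hA⟩ := hA.exists_smul_oprod h.orthonormal_left h.span_left
  obtain ⟨εB, hεB, hB0, hB⟩ := hB.exists_smul_oprod h.orthonormal_right h.span_right
  have hε : |εA * εB| = 1 := by
    rcases hεA with rfl | rfl <;> rcases hεB with rfl | rfl <;> simp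
  have hε0 : εA * εB ≠ 0 := fun h0 => by simp [h0] at hε
  set ε := εA * εB with hε_def
  set m := GA.mid r s t with hm
  set T := GA.last r t with hT
  set P := GA.oprod m fun k => GA.rotor (θ k) (i k)
  set κ : Finset (Fin r) → ℝ :=
    fun S => (∏ k ∈ S, Real.sin (θ k)) * ∏ k ∈ m \ S, Real.cos (θ k) with hκ
  have hcomm : ∀ k l, Commute (i k) (i l) := h.commute_unitBivector
  have hgrade : ∀ S : Finset (Fin r), GA.IsKVector (2 * S.card) (GA.oprod S i) :=
    h.isKVector_oprod
  have hst_le := hst.add_le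
  have hmT : Disjoint m T := GA.disjoint_mid_last r s t
  have hTcard : T.card = t := GA.card_last (by omega)
  have hmcard : m.card = r - s - t := GA.card_mid hst_le
  have hm0 : ∀ k ∈ m, θ k ≠ 0 := fun k hk => by
    rw [Ne, hst.eq_zero_iff]
    simp only [hm, GA.mid, Finset.mem_filter] at hk
    omega
  have hm1 : ∀ k ∈ m, θ k ≠ Real.pi / 2 := fun k hk => by
    rw [Ne, hst.eq_pi_div_two_iff]
    simp only [hm, GA.mid, Finset.mem_filter] at hk
    omega
  have hT0 : ∀ k ∈ T, θ k ≠ 0 := fun k hk => by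
    rw [Ne, hst.eq_zero_iff]
    simp only [hT, GA.last, Finset.mem_filter] at hk
    omega
  have hmT0 : ∀ k ∈ m ∪ T, θ k ≠ 0 := fun k hk =>
    (Finset.mem_union.1 hk).elim (hm0 k) (hT0 k)
  have hsq : ∀ k, θ k ≠ 0 → i k * i k = -1 := fun k hk => h.unitBivector_mul_self hk
  have hunit : ∀ S : Finset (Fin r), (∀ k ∈ S, θ k ≠ 0) → IsUnit (GA.oprod S i) :=
    fun S hS => GA.isUnit_oprod fun k hk =>
      ⟨⟨i k, -i k, by rw [mul_neg, hsq k (hS k hk), neg_neg],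
        by rw [neg_mul, hsq k (hS k hk), neg_neg]⟩, rfl⟩
  have hcos : 0 < ∏ k ∈ m, Real.cos (θ k) := Finset.prod_pos fun k hk => h.cos_pos (hm1 k hk)
  have hsin : 0 < ∏ k ∈ m, Real.sin (θ k) := Finset.prod_pos fun k hk => h.sin_pos (hm0 k hk)
  have hκ_empty : κ ∅ = ∏ k ∈ m, Real.cos (θ k) := by simp [hκ]
  have hκ_mid : κ m = ∏ k ∈ m, Real.sin (θ k) := by simp [hκ]
  have hPsum : P = ∑ S ∈ m.powerset, κ S • GA.oprod S i := GA.oprod_rotor_eq_sum hcomm θ m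
  have hMP : M = ε • (P * GA.oprod T i) := by
    have h1 : A * CliffordAlgebra.reverse B =
        ((εA * GA.modulus A) * (εB * GA.modulus B)) • (P * GA.oprod T i) := by
      rw [← GA.oprod_univ_rotor hcomm hst, ← h.oprod_vec_mul_reverse, ← smul_mul_smul_comm,
        ← map_smul, ← hA, ← hB]
    rw [hM, GA.normedProduct, h1, smul_smul]
    congr 1
    rw [hε_def]
    field_simp
  have hMsum : M = ε • ∑ S ∈ m.powerset, κ S • GA.oprod (S ∪ T) i := by
    rw [hMP, hPsum, Finset.sum_mul]
    congr 1
    refine Finset.sum_congr rfl fun S hS => ?_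
    rw [GA.oprod_union hcomm (hmT.mono_left (Finset.mem_powerset.1 hS)), smul_mul_assoc]
  have hLeq : L = (ε * ∏ k ∈ m, Real.cos (θ k)) • GA.oprod T i := by
    rw [hL, hMsum, GA.gradePart_smul, ← hTcard,
      GA.gradePart_sum_smul_oprod_lowest hgrade κ hmT, hκ_empty, smul_smul]
  -- Needed for `Ring.inverse L`, which is `0` on non-units, to be a true inverse.
  have hLunit : IsUnit L := by
    rw [hLeq]
    exact (hunit T hT0).smul (Units.mk0 _ (mul_ne_zero hε0 hcos.ne'))
  have hrs : r - s = m.card + T.card := by omega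
  have hHeq : GA.gradePart (2 * (r - s)) M =
      (ε * ∏ k ∈ m, Real.sin (θ k)) • GA.oprod (m ∪ T) i := by
    rw [hMsum, GA.gradePart_smul, hrs, GA.gradePart_sum_smul_oprod_highest hgrade κ hmT, hκ_mid,
      smul_smul]
  set C := ∏ k ∈ m, Real.cos (θ k)
  -- `L` carries the sign `ε` and the factor `C`, so dividing by it cancels `ε` and scales `P` by
  -- `C⁻¹`.
  have hML : M = (C⁻¹ • P) * L := by
    rw [hLeq, hMP, smul_mul_smul_comm, mul_comm ε, ← mul_assoc, inv_mul_cancel₀ hcos.ne', one_mul]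
  have hLM : M = L * (C⁻¹ • P) := by
    rw [hML, hLeq]
    exact (((GA.commute_oprod_rotor_oprod hcomm θ m T).smul_left _).smul_right _).eq
  have hDP : D = C⁻¹ • P := by
    rw [hD, hML, Ring.mul_inverse_cancel_right _ _ hLunit]
  -- The empty union puts `D` in the form of the grade lemmas with `T = ∅`.
  have hDsum : D = ∑ S ∈ m.powerset, (C⁻¹ * κ S) • GA.oprod (S ∪ ∅) i := by
    rw [hDP, hPsum, Finset.smul_sum]
    exact Finset.sum_congr rfl fun S _ => by rw [smul_smul, Finset.union_empty]
  refine ⟨h.finrank_inf hst, h.vec_mul_vec, fun k hk => hsq k ?_, hcomm, εA, εB, ε, hεA, hεB,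
    rfl, hA, hB, hMP, ?_, fun j hj => ?_, hLunit.ne_zero, hLeq, ?_, fun j hj => ?_, ?_, ?_, ?_,
    hLunit, ?_, fun j hj => ?_, ?_, ?_, ?_⟩
  · rw [Ne, hst.eq_zero_iff]
    omega
  · rw [hMP, hPsum]
  · rw [hMsum, GA.gradePart_smul, GA.gradePart_sum_smul_oprod_of_lt hgrade κ hmT (by omega),
      smul_zero]
  · rw [hLeq, GA.modulus_smul_of_mul_reverse_eq_one (h.oprod_mul_reverse hT0), abs_mul, hε, one_mul,
      abs_of_pos hcos]
  · rw [hMsum, GA.gradePart_smul, GA.gradePart_sum_smul_oprod_of_gt hgrade κ hmT (by omega),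
      smul_zero]
  · rw [hHeq]
    exact smul_ne_zero (mul_ne_zero hε0 hsin.ne') (hunit _ hmT0).ne_zero
  · rw [hHeq, GA.oprod_union hcomm hmT]
  · rw [hHeq, GA.modulus_smul_of_mul_reverse_eq_one (h.oprod_mul_reverse hmT0), abs_mul, hε,
      one_mul, abs_of_pos hsin]
  · rw [hDP, hLM, Ring.inverse_mul_cancel_left _ _ hLunit]
  · rw [hDsum]
    refine GA.gradePart_sum_smul_oprod_of_gt hgrade _ (Finset.disjoint_empty_right m) ?_
    rw [hmcard, Finset.card_empty, add_zero]
    exact hj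
  · have h1 := GA.gradePart_sum_smul_oprod_highest hgrade (fun S => C⁻¹ * κ S)
      (Finset.disjoint_empty_right m)
    rw [← hDsum, hmcard, Finset.card_empty, add_zero, Finset.union_empty, hκ_mid] at h1
    rw [h1]
    exact smul_ne_zero (mul_ne_zero (inv_ne_zero hcos.ne') hsin.ne') (hunit _ hm0).ne_zero
  · have h1 := GA.gradePart_sum_smul_oprod_lowest hgrade (fun S => C⁻¹ * κ S)
      (Finset.disjoint_empty_right m)
    rwa [← hDsum, Finset.card_empty, mul_zero, hκ_empty, inv_mul_cancel₀ hcos.ne', one_smul,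
      GA.oprod_empty] at h1
  · rw [hDsum, GA.gradePart_two_sum_smul_oprod hgrade]
    refine Finset.sum_congr rfl fun k hk => ?_
    congr 1
    -- The coefficient of `i k` is `sin θ_k` times the other cosines over `C`; all but `cos θ_k`
    -- cancel, leaving the tangent.
    have h1 : Real.cos (θ k) * ∏ l ∈ m \ {k}, Real.cos (θ l) = C := by
      rw [Finset.sdiff_singleton_eq_erase, Finset.mul_prod_erase m (fun l => Real.cos (θ l)) hk]
    have h2 := (h.cos_pos (hm1 k hk)).ne'
    have h3 : C ≠ 0 := hcos.ne'
    simp only [hκ, Finset.prod_singleton]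
    rw [Real.tan_eq_sin_div_cos, eq_div_iff h2, inv_mul_eq_div, div_mul_eq_mul_div,
      div_eq_iff h3, ← h1]
    ring
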